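/- A \emph{plane map} $G$ consists of finitely many distinct points of the plane $\mathbb{R}^2$ (vertices) and finitely many edges. Each edge is a continuous arc joining two vertices (or, for a loop, a simple closed curve through one vertex) that passes through no other vertex, and distinct edges meet at most in common end vertices. Loops and parallel edges are allowed, and $G$ need not be connected. The \emph{faces} of $G$ are the connected components of the complement in $\mathbb{R}^2$ of the union of its vertices and edges, and two faces \emph{share an edge} if some edge is contained in the boundary of both. The map $G$ is \emph{outerplanar} if every vertex lies on the boundary of the outer (unbounded) face. A sequence is \emph{non-repetitive} if it contains no two identical adjacent non-empty blocks. A colouring of the faces of $G$ is \emph{non-repetitive} if, for every finite sequence of distinct faces in which each consecutive pair of faces shares an edge, the sequence of their colours is non-repetitive. \textbf{Theorem.} If $G$ is an outerplanar map, then the faces of $G$ (including the outer face) can be non-repetitively coloured using at most five colours. -/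

import Mathlib

/-- A sequence is non-repetitive if it contains no two identical adjacent (non-empty) blocks. -/
def NonrepetitiveSeq {α : Type*} (w : List α) : Prop :=
  ∀ u : List α, u ≠ [] → ¬ (u ++ u) <:+: w

/-- A map drawn in the plane `ℂ = ℝ²`, with vertex set `V` and edge set `E`: the vertices are
distinct points, every edge is an arc joining its two ends (a simple closed curve if the ends
coincide), edges do not pass through vertices, and distinct edges meet at most in common ends.
Loops and parallel edges are allowed, and connectedness is not required. -/
structure PlaneMap (V E : Type*) where
  /-- the point of the plane at which a vertex is drawn -/
  pos : V → ℂ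
  /-- one end of an edge; the order of the two ends carries no meaning -/
  fst : E → V
  /-- the other end of an edge -/
  snd : E → V
  /-- the continuous curve along which an edge is drawn -/
  arc : (e : E) → Path (pos (fst e)) (pos (snd e))
  pos_injective : Function.Injective pos
  arc_injOn : ∀ e, Set.InjOn (arc e) (Set.Ioo 0 1)
  arc_ne_pos : ∀ e, ∀ t ∈ Set.Ioo (0 : unitInterval) 1, ∀ v, arc e t ≠ pos v
  arc_disjoint : ∀ e f, e ≠ f → Disjoint (arc e '' Set.Ioo 0 1) (arc f '' Set.Ioo 0 1)

namespace PlaneMap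

variable {V E : Type*}

/-- The set of points of the plane covered by the vertices and edges. -/
def support (G : PlaneMap V E) : Set ℂ :=
  Set.range G.pos ∪ ⋃ e, Set.range (G.arc e)

/-- The faces are the connected components of the complement of the drawing. -/
def IsFace (G : PlaneMap V E) (F : Set ℂ) : Prop :=
  ∃ z ∈ G.supportᶜ, F = connectedComponentIn G.supportᶜ z

/-- The type of faces, the outer face included. -/
abbrev Face (G : PlaneMap V E) : Type := {F : Set ℂ // G.IsFace F}

/-- Two faces share an edge if some edge lies on the boundary of both. -/
def ShareEdge (G : PlaneMap V E) (F F' : G.Face) : Prop :=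
  ∃ e, Set.range (G.arc e) ⊆ frontier F.1 ∩ frontier F'.1

/-- The map is outerplanar if every vertex lies on the boundary of the outer (unbounded) face. -/
def IsOuterplanar (G : PlaneMap V E) : Prop :=
  ∃ F, G.IsFace F ∧ ¬ Bornology.IsBounded F ∧ ∀ v, G.pos v ∈ frontier F

/-- A colouring of the faces is non-repetitive if the colours along every sequence of distinct
faces in which consecutive faces share an edge form a non-repetitive sequence. -/
def IsNonrepetitive (G : PlaneMap V E) {C : Type*} (c : G.Face → C) : Prop :=
  ∀ l : List G.Face, l.Nodup → l.IsChain G.ShareEdge → NonrepetitiveSeq (l.map c)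

end PlaneMap

/-! Let `O` be the outer face. The other faces form a forest under sharing an edge. Indeed, an edge
`e` between faces `F ≠ F'` has both ends on the boundary of `O`, so `e` together with `O` separates
`F` from `F'`; any other chain of faces from `F` to `F'` would yield a path avoiding both. The
separation follows from Janiszewski's theorem, which is proved with continuous logarithms of `(z -
a) / (z - b)`.

A forest has a non-repetitive colouring with four colours: root each component and colour a vertex
by the letter, at its depth, of a square-free word without palindromes of length two or three. Along
a path the depth first falls and then rises. A square on a monotone path would be a square in the
word; one on a path that turns would force equal letters at distance one or two.

The fifth colour is kept for `O`, which a sequence of distinct faces visits at most once, so no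
square contains it. -/

/-! ### Square-free words from the Thue–Morse sequence -/

/-- The Thue–Morse sequence. -/
def thueMorse (n : ℕ) : Bool :=
  if n = 0 then false else xor (thueMorse (n / 2)) (n % 2 = 1)
decreasing_by omega

theorem thueMorse_two_mul (n : ℕ) : thueMorse (2 * n) = thueMorse n := by
  rcases Nat.eq_zero_or_pos n with rfl | h
  · rfl
  · rw [thueMorse, if_neg (by omega)]
    simp

theorem thueMorse_two_mul_add_one (n : ℕ) : thueMorse (2 * n + 1) = !thueMorse n := by
  rw [thueMorse, if_neg (by omega), show (2 * n + 1) / 2 = n by omega,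
    show (2 * n + 1) % 2 = 1 by omega]
  simp

theorem thueMorse_succ_of_even {n : ℕ} (h : n % 2 = 0) :
    thueMorse (n + 1) = !thueMorse n := by
  obtain ⟨m, rfl⟩ : ∃ m, n = 2 * m := ⟨n / 2, by omega⟩
  rw [thueMorse_two_mul_add_one, thueMorse_two_mul]

/-- The Thue–Morse sequence contains no overlap. -/
theorem thueMorse_overlapFree (p i : ℕ) (hp : 0 < p) :
    ∃ k ≤ p, thueMorse (i + k) ≠ thueMorse (i + k + p) := by
  induction p using Nat.strong_induction_on generalizing i with
  | _ p ih =>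
    by_contra! H
    rcases Nat.mod_two_eq_zero_or_one p with h | h
    -- For even `p`, the letters at positions of the same parity as `i` form, up to complementation,
    -- an overlap of half the period.
    · obtain ⟨q, rfl⟩ : ∃ q, p = 2 * q := ⟨p / 2, by omega⟩
      obtain ⟨k, hk, hne⟩ := ih q (by omega) (i / 2) (by omega)
      have := H (2 * k) (by omega)
      rcases Nat.mod_two_eq_zero_or_one i with hi | hi
      · rw [show i + 2 * k = 2 * (i / 2 + k) by omega,
          show 2 * (i / 2 + k) + 2 * q = 2 * (i / 2 + k + q) by omega,
          thueMorse_two_mul, thueMorse_two_mul] at this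
        exact hne this
      · rw [show i + 2 * k = 2 * (i / 2 + k) + 1 by omega,
          show 2 * (i / 2 + k) + 1 + 2 * q = 2 * (i / 2 + k + q) + 1 by omega,
          thueMorse_two_mul_add_one, thueMorse_two_mul_add_one] at this
        exact hne (by simpa using this)
    -- For odd `p`, one of `i + k` and `i + k + p` is even, and an even position is followed by the
    -- opposite letter. So the letters alternate from `i` to `i + p`, and those two end letters
    -- differ.
    · have alt : ∀ k < p, thueMorse (i + (k + 1)) = !thueMorse (i + k) := by
        intro k hk
        rcases Nat.mod_two_eq_zero_or_one (i + k) with hi | hi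
        · exact thueMorse_succ_of_even hi
        · rw [H (k + 1) (by omega), H k (by omega), ← thueMorse_succ_of_even (by omega)]
          congr 1
          omega
      have key : ∀ k ≤ p, thueMorse (i + k) = xor (thueMorse i) (k % 2 = 1) := by
        intro k
        induction k with
        | zero => simp
        | succ k ihk =>
          intro hk
          rw [alt k (by omega), ihk (by omega)]
          rcases Nat.mod_two_eq_zero_or_one k with hk' | hk' <;>
            simp [hk', Nat.add_mod]
      have h0 := H 0 (by omega)
      have hp' := key p le_rfl
      simp only [add_zero] at h0
      rw [← h0, h] at hp'
      simp at hp'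

/-- The ternary sequence of differences of consecutive Thue–Morse letters. -/
def thueMorseDiff (n : ℕ) : ℤ := (thueMorse (n + 1)).toInt - (thueMorse n).toInt

theorem sum_thueMorseDiff (i k : ℕ) :
    ∑ j ∈ Finset.range k, thueMorseDiff (i + j) =
      (thueMorse (i + k)).toInt - (thueMorse i).toInt := by
  exact Finset.sum_range_sub (fun j => (thueMorse (i + j)).toInt) k

/-- Summing the differences over a square shows that the Thue–Morse letters at `i`, `i + p`, `i +
2p` are in arithmetic progression. Being 0 or 1 they are equal, so the square integrates to an
overlap. -/
theorem thueMorseDiff_squareFree (p i : ℕ) (hp : 0 < p) :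
    ∃ k < p, thueMorseDiff (i + k) ≠ thueMorseDiff (i + k + p) := by
  by_contra! H
  have inj : Function.Injective Bool.toInt := by decide
  have hk : ∀ k ≤ p, (thueMorse (i + k)).toInt - (thueMorse i).toInt =
      (thueMorse (i + k + p)).toInt - (thueMorse (i + p)).toInt := by
    intro k hk
    rw [← sum_thueMorseDiff, show i + k + p = i + p + k by ring, ← sum_thueMorseDiff]
    refine Finset.sum_congr rfl fun j hj => ?_
    rw [H j (by have := Finset.mem_range.1 hj; omega)]
    congr 1
    ring
  have h0 : (thueMorse i).toInt = (thueMorse (i + p)).toInt := by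
    have := hk p le_rfl
    revert this
    cases thueMorse i <;> cases thueMorse (i + p) <;> cases thueMorse (i + p + p) <;> decide
  obtain ⟨k, hkp, hne⟩ := thueMorse_overlapFree p i hp
  exact hne (inj (by have := hk k hkp; omega))

theorem thueMorseDiff_bounds (n : ℕ) : -1 ≤ thueMorseDiff n ∧ thueMorseDiff n ≤ 1 := by
  unfold thueMorseDiff
  cases thueMorse (n + 1) <;> cases thueMorse n <;> decide

/-- A sequence over four letters, without squares and without palindromes of length two or
three: a separating letter is put between consecutive pairs of letters of a square-free ternary
sequence. -/
def palindromeFreeWord (n : ℕ) : Fin 4 :=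
  if n % 3 = 2 then 3 else
    if thueMorseDiff (2 * (n / 3) + n % 3) = 0 then 0 else
      if thueMorseDiff (2 * (n / 3) + n % 3) = 1 then 1 else 2

theorem palindromeFreeWord_eq_iff (m n : ℕ) : palindromeFreeWord m = palindromeFreeWord n ↔
    (m % 3 = 2 ∧ n % 3 = 2) ∨ (m % 3 ≠ 2 ∧ n % 3 ≠ 2 ∧
      thueMorseDiff (2 * (m / 3) + m % 3) = thueMorseDiff (2 * (n / 3) + n % 3)) := by
  have hm := thueMorseDiff_bounds (2 * (m / 3) + m % 3)
  have hn := thueMorseDiff_bounds (2 * (n / 3) + n % 3)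
  unfold palindromeFreeWord
  generalize thueMorseDiff (2 * (m / 3) + m % 3) = a at *
  generalize thueMorseDiff (2 * (n / 3) + n % 3) = b at *
  split_ifs <;> simp_all <;> omega

theorem thueMorseDiff_ne_succ (n : ℕ) : thueMorseDiff n ≠ thueMorseDiff (n + 1) := by
  obtain ⟨k, hk, h⟩ := thueMorseDiff_squareFree 1 n one_pos
  obtain rfl : k = 0 := by omega
  exact h

theorem palindromeFreeWord_ne_succ (n : ℕ) :
    palindromeFreeWord n ≠ palindromeFreeWord (n + 1) := by
  rw [Ne, palindromeFreeWord_eq_iff]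
  rintro (h | ⟨h, h', h''⟩)
  · omega
  · have := thueMorseDiff_ne_succ (2 * (n / 3))
    rw [show n % 3 = 0 by omega, show (n + 1) % 3 = 1 by omega,
      show (n + 1) / 3 = n / 3 by omega] at h''
    exact this h''

theorem palindromeFreeWord_ne_add_two (n : ℕ) :
    palindromeFreeWord n ≠ palindromeFreeWord (n + 2) := by
  rw [Ne, palindromeFreeWord_eq_iff]
  rintro (h | ⟨h, h', h''⟩)
  · omega
  · have := thueMorseDiff_ne_succ (2 * (n / 3) + 1)
    rw [show n % 3 = 1 by omega, show (n + 2) % 3 = 0 by omega,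
      show (n + 2) / 3 = n / 3 + 1 by omega] at h''
    exact this h''

/-- The separators occupy exactly the positions 2 mod 3, so the period of a long square is a
multiple `3 * q` of 3. Deleting the separators leaves a square of period `2 * q` in the ternary
word. -/
theorem palindromeFreeWord_squareFree (p i : ℕ) (hp : 0 < p) :
    ∃ k < p, palindromeFreeWord (i + k) ≠ palindromeFreeWord (i + k + p) := by
  by_contra! H
  rcases lt_or_ge p 3 with h3 | h3
  · obtain rfl | rfl : p = 1 ∨ p = 2 := by omega
    · exact palindromeFreeWord_ne_succ i (H 0 (by omega))
    · exact palindromeFreeWord_ne_add_two i (H 0 (by omega))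
  have hmod : p % 3 = 0 := by
    -- `(5 - i % 3) % 3` is the distance from `i` to the first separator at or after it.
    have := (palindromeFreeWord_eq_iff _ _).1 (H ((5 - i % 3) % 3) (by omega))
    omega
  obtain ⟨q, rfl⟩ : ∃ q, p = 3 * q := ⟨p / 3, by omega⟩
  obtain ⟨k, hk, hne⟩ := thueMorseDiff_squareFree (2 * q) (2 * (i / 3) + i % 3) (by omega)
  -- the position in the long word of the letter at position `2 * (i / 3) + i % 3 + k`
  obtain ⟨n, hn⟩ : ∃ n, n = 3 * ((2 * (i / 3) + i % 3 + k) / 2) + (2 * (i / 3) + i % 3 + k) % 2 :=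
    ⟨_, rfl⟩
  have := (palindromeFreeWord_eq_iff _ _).1 (H (n - i) (by omega))
  rw [show i + (n - i) = n by omega, show 2 * (n / 3) + n % 3 = 2 * (i / 3) + i % 3 + k by omega,
    show 2 * ((n + 3 * q) / 3) + (n + 3 * q) % 3 = 2 * (i / 3) + i % 3 + k + 2 * q by omega] at this
  rcases this with h | h
  · omega
  · exact hne h.2.2

/-- A sequence of integers with steps `±1` and without interior local maximum cannot be read along
the square-free and palindrome-free word so as to give a square. -/
theorem palindromeFreeWord_comp_not_square (p : ℕ) (hp : 0 < p) (D : ℕ → ℕ)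
    (hstep : ∀ i, i + 1 < 2 * p → D (i + 1) = D i + 1 ∨ D i = D (i + 1) + 1)
    (hpeak : ∀ i, i + 2 < 2 * p → D (i + 1) = D i + 1 → D (i + 2) = D (i + 1) + 1) :
    ∃ k < p, palindromeFreeWord (D k) ≠ palindromeFreeWord (D (k + p)) := by
  by_contra! H
  have up : ∀ i j, i + 1 < 2 * p → D (i + 1) = D i + 1 → i + j < 2 * p → D (i + j) = D i + j := by
    intro i j hi h hj
    have : ∀ j, i + (j + 1) < 2 * p → D (i + j + 1) = D (i + j) + 1 ∧ D (i + j) = D i + j := by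
      intro j
      induction j with
      | zero => exact fun _ => ⟨h, rfl⟩
      | succ j ih =>
        intro hj
        obtain ⟨h1, h2⟩ := ih (by omega)
        exact ⟨hpeak (i + j) (by omega) h1, by rw [← add_assoc, h1, h2]; ring⟩
    rcases j with _ | j
    · rfl
    · have := this j hj
      rw [← add_assoc]
      omega
  have down : ∀ j i, i + 1 < 2 * p → D i = D (i + 1) + 1 → j ≤ i + 1 →
      D (i + 1 - j) = D (i + 1) + j := by
    intro j
    induction j with
    | zero => intros; rfl
    | succ j ih =>
      intro i hi h hj
      have h1 := ih i hi h (by omega)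
      have h2 : i + 1 - j = (i + 1 - (j + 1)) + 1 := by omega
      rcases hstep (i + 1 - (j + 1)) (by omega) with h3 | h3
      · have := up _ j (by omega) h3 (by omega)
        have h4 : i + 1 - (j + 1) + j = i := by omega
        have := up _ (j + 1) (by omega) h3 (by omega)
        have h5 : i + 1 - (j + 1) + (j + 1) = i + 1 := by omega
        grind
      · rw [h3, ← h2, h1]
        ring
  have key : ∀ n m, m ≤ n + 2 → n ≤ m + 2 → palindromeFreeWord m = palindromeFreeWord n →
      m = n := by
    intro n m h1 h2 h
    by_contra hne
    obtain rfl | rfl | rfl | rfl : m = n + 1 ∨ m = n + 2 ∨ n = m + 1 ∨ n = m + 2 := by omega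
    · exact palindromeFreeWord_ne_succ n h.symm
    · exact palindromeFreeWord_ne_add_two n h.symm
    · exact palindromeFreeWord_ne_succ m h
    · exact palindromeFreeWord_ne_add_two m h
  by_cases hmono : ∃ i, i + 2 < 2 * p ∧ D i = D (i + 1) + 1 ∧ D (i + 2) = D (i + 1) + 1
  · obtain ⟨i, hi, hd, hu⟩ := hmono
    -- The sum of the two truncated differences is the distance from `j` to the minimum `i + 1`.
    have hD : ∀ j < 2 * p, D j = D (i + 1) + ((i + 1 - j) + (j - (i + 1))) := by
      intro j hj
      rcases le_total j (i + 1) with h | h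
      · have := down (i + 1 - j) i (by omega) hd (by omega)
        rw [show i + 1 - (i + 1 - j) = j by omega] at this
        omega
      · have := up (i + 1) (j - (i + 1)) hi hu (by omega)
        rw [show i + 1 + (j - (i + 1)) = j by omega] at this
        omega
    have clash : ∀ k < p, D k = D (k + p) ∨ D k + 2 < D (k + p) ∨ D (k + p) + 2 < D k := by
      intro k hk
      by_contra! hc
      exact hc.1 (key _ _ (by omega) (by omega) (H k hk))
    -- If the minimum is at neither `p - 1` nor `p`, its two neighbours have equal depth, while
    -- their copies in the other half lie on a monotone stretch and give a palindrome of length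
    -- three. If it is at `p - 1` or `p`, the index chosen near the middle of the first half and its
    -- copy have depths differing by one or two.
    rcases lt_trichotomy (i + 1) p with h | h | h
    · rcases Nat.lt_or_ge (i + 2) p with h' | h'
      · have h1 := H i (by omega)
        have h2 := H (i + 2) (by omega)
        have e1 := hD (i + p) (by omega)
        have e2 := hD (i + 2 + p) (by omega)
        have := key (D (i + 2 + p)) (D (i + p)) (by omega) (by omega)
          (by rw [← h1, ← h2, hd, hu])
        omega
      · have c := clash (p / 2) (by omega)
        have e1 := hD (p / 2) (by omega)
        have e2 := hD (p / 2 + p) (by omega)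
        omega
    · have c := clash ((p - 1) / 2) (by omega)
      have e1 := hD ((p - 1) / 2) (by omega)
      have e2 := hD ((p - 1) / 2 + p) (by omega)
      omega
    · have h1 := H (i - p) (by omega)
      have h2 := H (i + 2 - p) (by omega)
      have e1 := hD (i - p) (by omega)
      have e2 := hD (i + 2 - p) (by omega)
      rw [show i - p + p = i by omega] at h1
      rw [show i + 2 - p + p = i + 2 by omega] at h2
      have := key (D (i + 2 - p)) (D (i - p)) (by omega) (by omega)
        (by rw [h1, h2, hd, hu])
      omega
  -- Without a turn `D` is monotone. A descent reads the word backwards, whence the index `p - 1 -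
  -- k`.
  · push Not at hmono
    rcases hstep 0 (by omega) with h | h
    · obtain ⟨k, hk, hne⟩ := palindromeFreeWord_squareFree p (D 0) hp
      have e1 := up 0 k (by omega) h (by omega)
      have e2 := up 0 (k + p) (by omega) h (by omega)
      rw [zero_add] at e1 e2
      rw [add_assoc, ← e2, ← e1] at hne
      exact hne (H k hk)
    · have alldown : ∀ i, i + 1 < 2 * p → D i = D (i + 1) + 1 := by
        intro i
        induction i with
        | zero => exact fun _ => h
        | succ i ih =>
          intro hi
          have := hmono i hi (ih (by omega))
          rcases hstep (i + 1) (by omega) with h | h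
          · exact absurd h this
          · exact h
      have hD : ∀ j < 2 * p, D j = D (2 * p - 1) + (2 * p - 1 - j) := by
        intro j hj
        have := down (2 * p - 1 - j) (2 * p - 2) (by omega) (alldown _ (by omega)) (by omega)
        rw [show 2 * p - 2 + 1 - (2 * p - 1 - j) = j by omega,
          show 2 * p - 2 + 1 = 2 * p - 1 by omega] at this
        exact this
      obtain ⟨k, hk, hne⟩ := palindromeFreeWord_squareFree p (D (2 * p - 1)) hp
      have := H (p - 1 - k) (by omega)
      rw [hD (p - 1 - k) (by omega), hD (p - 1 - k + p) (by omega)] at this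
      apply hne
      convert this.symm using 2
      · omega
      · omega

/-! ### Non-repetitive colouring of forests -/

namespace SimpleGraph

variable {α : Type*} {T : SimpleGraph α}

/-- A vertex of a forest has at most one neighbour closer to a given vertex. -/
theorem IsAcyclic.eq_of_adj_of_dist_lt (hT : T.IsAcyclic) {r x y z : α} (hr : T.Reachable r y)
    (hx : T.Adj x y) (hz : T.Adj z y) (hxy : T.dist r x < T.dist r y)
    (hzy : T.dist r z < T.dist r y) : x = z := by
  -- A shortest path from `w` to `r` cannot pass through the farther vertex `y`, so it extends to a
  -- path from `y`; paths in a forest are unique.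
  have ext : ∀ w, T.Adj w y → T.dist r w < T.dist r y →
      ∃ q : T.Walk y r, q.IsPath ∧ q.snd = w := by
    intro w hw hlt
    obtain ⟨q, hq, hlen⟩ := (hw.reachable.trans hr.symm).exists_path_of_dist
    refine ⟨Walk.cons hw.symm q, ?_, by simp⟩
    rw [Walk.cons_isPath_iff]
    refine ⟨hq, fun hmem => ?_⟩
    classical
    have h1 := dist_le (q.dropUntil y hmem)
    have h2 := q.length_dropUntil_le_length hmem
    rw [T.dist_comm (u := y), T.dist_comm (u := w)] at *
    omega
  obtain ⟨p, hp, rfl⟩ := ext x hx hxy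
  obtain ⟨q, hq, rfl⟩ := ext z hz hzy
  have := (hT.subsingleton_path _ _).elim ⟨p, hp⟩ ⟨q, hq⟩
  rw [Subtype.mk.injEq] at this
  rw [this]

/-- Forests can be non-repetitively coloured with four colours. -/
theorem IsAcyclic.exists_nonrepetitive_coloring (hT : T.IsAcyclic) :
    ∃ c : α → Fin 4, ∀ l : List α, l.Nodup → l.IsChain T.Adj → NonrepetitiveSeq (l.map c) := by
  set root : α → α := fun v => (T.connectedComponentMk v).out with hroot
  have hreach : ∀ v, T.Reachable (root v) v := fun v =>
    ConnectedComponent.exact (Quot.out_eq (T.connectedComponentMk v))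
  have hadj : ∀ {v w}, T.Adj v w → root v = root w := fun h => by
    simp only [hroot]
    rw [ConnectedComponent.sound h.reachable]
  refine ⟨fun v => palindromeFreeWord (T.dist (root v) v), fun l hnd hch u hu hsq => ?_⟩
  obtain ⟨a, b, hab⟩ := hsq
  have hlen : l.length = a.length + (u.length + u.length) + b.length := by
    simpa [add_assoc] using (congrArg List.length hab).symm
  have hp : 0 < u.length := List.length_pos_iff.2 hu
  have : Nonempty α := by
    rcases l with _ | ⟨v, l⟩
    · simp at hlen; omega
    · exact ⟨v⟩
  -- `v` lists `l` from the start of the square; its values beyond the end of `l` are arbitrary.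
  obtain ⟨v, hv⟩ : ∃ v : ℕ → α, ∀ i (hi : a.length + i < l.length), v i = l[a.length + i] :=
    ⟨fun i => if hi : a.length + i < l.length then l[a.length + i] else Classical.arbitrary α,
      fun i hi => by simp [hi]⟩
  have hva : ∀ i, i + 1 < 2 * u.length → T.Adj (v i) (v (i + 1)) := by
    intro i hi
    rw [hv i (by omega), hv (i + 1) (by omega)]
    exact List.isChain_iff_getElem.1 hch _ _
  have hvr : ∀ i, i < 2 * u.length → root (v i) = root (v 0) := by
    intro i
    induction i with
    | zero => exact fun _ => rfl
    | succ i ih => exact fun hi => (hadj (hva i hi)).symm.trans (ih (by omega))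
  have hvw : ∀ i < 2 * u.length, T.Reachable (root (v 0)) (v i) := fun i hi =>
    hvr i hi ▸ hreach (v i)
  obtain ⟨k, hk, hne⟩ := palindromeFreeWord_comp_not_square u.length hp
    (fun i => T.dist (root (v 0)) (v i))
    (fun i hi => (hT.dist_eq_dist_add_one_of_adj_of_reachable _ (hva i hi)
      (hvw i (by omega))).symm)
    (fun i hi h => by
      rcases hT.dist_eq_dist_add_one_of_adj_of_reachable _ (hva (i + 1) hi)
        (hvw (i + 1) (by omega)) with h' | h'
      -- At a peak both neighbours would be the unique parent, but the vertices of `l` are distinct.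
      · have := hT.eq_of_adj_of_dist_lt (hvw (i + 1) (by omega)) (hva i (by omega))
          (hva (i + 1) hi).symm (by omega) (by omega)
        rw [hv i (by omega), hv (i + 1 + 1) (by omega), hnd.getElem_inj_iff] at this
        omega
      · exact h')
  apply hne
  have get : ∀ i (hi : i < 2 * u.length),
      palindromeFreeWord (T.dist (root (v 0)) (v i)) = (u ++ u)[i]'(by simp; omega) := by
    intro i hi
    rw [← hvr i hi, hv i (by omega)]
    have h1 : (l.map fun v => palindromeFreeWord (T.dist (root v) v))[a.length + i]'(by
        simp; omega) = (u ++ u)[i]'(by simp; omega) := by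
      simp only [← hab]
      rw [List.getElem_append_left (by simp; omega), List.getElem_append_right (by omega)]
      simp
    rw [← h1]
    simp
  rw [get k (by omega), get (k + u.length) (by omega), List.getElem_append_left hk,
    List.getElem_append_right (by omega)]
  simp

end SimpleGraph

/-! ### Continuous logarithms and separation in the plane -/

section PlaneTopology

open Set Metric Filter Topology

/-- The function `f` has a continuous logarithm on the set `s`. -/
def HasContinuousLogOn (f : ℂ → ℂ) (s : Set ℂ) : Prop :=
  ∃ g : ℂ → ℂ, ContinuousOn g s ∧ ∀ z ∈ s, Complex.exp (g z) = f z

/-- If `a` and `b` lie in a connected set disjoint from the closed set `A`, then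
`(z - a) / (z - b)` has a continuous logarithm on `A`. -/
theorem hasContinuousLogOn_div_of_isPreconnected {A S : Set ℂ} (hA : IsClosed A)
    (hS : IsPreconnected S) (hSA : S ⊆ Aᶜ) {a b : ℂ} (ha : a ∈ S) (hb : b ∈ S) :
    HasContinuousLogOn (fun z => (z - a) / (z - b)) A := by
  have hne : ∀ {z x}, z ∈ A → x ∈ S → z - x ≠ 0 := fun hz hx h =>
    hSA hx (sub_eq_zero.1 h ▸ hz)
  -- Having a logarithm is transitive and symmetric in the pair of points, so nearby points suffice.
  -- For these, the inverse quotient is `1 + (x - y) / (z - x)`, whose second term has norm below 1.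
  refine hS.induction₂ (fun a b => HasContinuousLogOn (fun z => (z - a) / (z - b)) A)
    ?_ ?_ ?_ ha hb
  · intro x hx
    obtain ⟨ε, hε, hball⟩ := Metric.isOpen_iff.1 hA.isOpen_compl x (hSA hx)
    filter_upwards [mem_nhdsWithin_of_mem_nhds (ball_mem_nhds x hε), self_mem_nhdsWithin]
      with y hy hyS
    have hslit : ∀ z ∈ A, 1 + (x - y) / (z - x) ∈ Complex.slitPlane := by
      intro z hz
      apply Complex.mem_slitPlane_of_norm_lt_one
      have h1 : ε ≤ ‖z - x‖ := by
        by_contra! h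
        exact hball (by rwa [mem_ball, dist_eq_norm]) hz
      rw [norm_div, div_lt_one (hε.trans_le h1), norm_sub_rev, ← dist_eq_norm]
      exact (mem_ball.1 hy).trans_le h1
    refine ⟨fun z => -Complex.log (1 + (x - y) / (z - x)), ?_, ?_⟩
    · refine (ContinuousOn.clog ?_ hslit).neg
      exact continuousOn_const.add (continuousOn_const.div
        (continuousOn_id.sub continuousOn_const) fun z hz => hne hz hx)
    · intro z hz
      have h0 := hne hz hx
      rw [Complex.exp_neg, Complex.exp_log (Complex.slitPlane_ne_zero (hslit z hz)),
        one_add_div h0, inv_div]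
      congr 1
      ring
  · rintro x y z hx hy hz ⟨g, hg, hg'⟩ ⟨h, hh, hh'⟩
    refine ⟨fun w => g w + h w, hg.add hh, fun w hw => ?_⟩
    rw [Complex.exp_add, hg' w hw, hh' w hw, div_mul_div_cancel₀ (hne hw hy)]
  · rintro x y hx hy ⟨g, hg, hg'⟩
    refine ⟨fun w => -g w, hg.neg, fun w hw => ?_⟩
    rw [Complex.exp_neg, hg' w hw, inv_div]

/-- Two continuous logarithms of a function on a connected set differ by a constant. -/
theorem sub_eq_sub_of_exp_eq_exp {α : Type*} [TopologicalSpace α] {S : Set α}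
    (hS : IsPreconnected S) {g h : α → ℂ} (hg : ContinuousOn g S) (hh : ContinuousOn h S)
    (heq : ∀ z ∈ S, Complex.exp (g z) = Complex.exp (h z)) {x y : α} (hx : x ∈ S) (hy : y ∈ S) :
    g x - h x = g y - h y := by
  refine hS.constant_of_mapsTo (f := fun z => g z - h z)
    (T := (AddSubgroup.zmultiples (2 * Real.pi * Complex.I) : Set ℂ)) ?_ (hg.sub hh) ?_ hx hy
  · rw [isDiscrete_iff_discreteTopology]
    exact NormedSpace.discreteTopology_zmultiples _
  · intro z hz
    obtain ⟨n, hn⟩ := Complex.exp_eq_exp_iff_exists_int.1 (heq z hz)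
    exact ⟨n, by simp [hn]⟩

/-- On the connected intersection the two logarithms differ by a constant; shifting one by it lets
them be glued. -/
theorem HasContinuousLogOn.union {f : ℂ → ℂ} {A B : Set ℂ} (hA : IsClosed A) (hB : IsClosed B)
    (hAB : IsConnected (A ∩ B)) (hfA : HasContinuousLogOn f A) (hfB : HasContinuousLogOn f B) :
    HasContinuousLogOn f (A ∪ B) := by
  classical
  obtain ⟨g, hg, hg'⟩ := hfA
  obtain ⟨h, hh, hh'⟩ := hfB
  obtain ⟨p, hp⟩ := hAB.nonempty
  have hc : Complex.exp (g p - h p) = 1 := by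
    rw [Complex.exp_sub, hg' p hp.1, hh' p hp.2, div_self]
    rw [← hg' p hp.1]
    exact Complex.exp_ne_zero _
  have hEq : ∀ z ∈ A ∩ B, g z = h z + (g p - h p) := by
    intro z hz
    rw [← sub_eq_sub_of_exp_eq_exp hAB.isPreconnected (hg.mono inter_subset_left)
      (hh.mono inter_subset_right) (fun w hw => by rw [hg' w hw.1, hh' w hw.2]) hz hp]
    ring
  have onB : ∀ z ∈ B, A.piecewise g (fun z => h z + (g p - h p)) z = h z + (g p - h p) := by
    intro z hz
    by_cases hzA : z ∈ A
    · rw [piecewise_eq_of_mem _ _ _ hzA, hEq z ⟨hzA, hz⟩]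
    · rw [piecewise_eq_of_notMem _ _ _ hzA]
  refine ⟨A.piecewise g (fun z => h z + (g p - h p)), ?_, ?_⟩
  · refine ContinuousOn.union_of_isClosed ?_ ?_ hA hB
    · exact hg.congr (piecewise_eqOn _ _ _)
    · exact (hh.add continuousOn_const).congr onB
  · rintro z (hz | hz)
    · rw [piecewise_eq_of_mem _ _ _ hz, hg' z hz]
    · rw [onB z hz, Complex.exp_add, hc, mul_one, hh' z hz]

/-- A continuous function on the plane without zeros cannot agree with `z - a` on a circle
around `a`. -/
theorem exists_ne_sub_of_continuous {φ : ℂ → ℂ} (hφ : Continuous φ) (h0 : ∀ z, φ z ≠ 0) (a : ℂ)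
    {ρ : ℝ} (hρ : 0 < ρ) : ∃ z, ‖z - a‖ = ρ ∧ φ z ≠ z - a := by
  by_contra! H
  -- A zero-free function on the plane has a global logarithm `ψ`. On the circle it would differ by
  -- a constant from `log ρ + iθ`, which is not `2π`-periodic.
  obtain ⟨ψ, ⟨-, hψ⟩, -⟩ := Complex.isCoveringMapOn_exp.existsUnique_continuousMap_lifts
    ⟨φ, hφ⟩ (a₀ := 0) (Complex.exp_log (h0 0)) h0
  have hψ' : ∀ z, Complex.exp (ψ z) = φ z := fun z => congrFun hψ z
  have key := sub_eq_sub_of_exp_eq_exp (S := (univ : Set ℝ)) isPreconnected_univ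
    (g := fun θ => ψ (a + ρ * Complex.exp (θ * Complex.I)))
    (h := fun θ => Complex.log ρ + θ * Complex.I) (by fun_prop) (by fun_prop)
    (fun θ _ => by
      rw [hψ', H _ (by simp [Complex.norm_exp, abs_of_pos hρ]), Complex.exp_add,
        Complex.exp_log (by exact_mod_cast hρ.ne')]
      ring) (mem_univ 0) (mem_univ (2 * Real.pi))
  simp [Complex.exp_two_pi_mul_I] at key

theorem frontier_connectedComponentIn_compl_subset {X : Set ℂ} (hX : IsClosed X) (a : ℂ) :
    frontier (connectedComponentIn Xᶜ a) ⊆ X := by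
  intro z hz
  by_contra hzX
  have hopen : IsOpen (connectedComponentIn Xᶜ a) := hX.isOpen_compl.connectedComponentIn
  have hzo : IsOpen (connectedComponentIn Xᶜ z) := hX.isOpen_compl.connectedComponentIn
  obtain ⟨w, hw, hw'⟩ := mem_closure_iff.1 hz.1 _ hzo (mem_connectedComponentIn hzX)
  have : z ∈ connectedComponentIn Xᶜ a := by
    rw [connectedComponentIn_eq hw', ← connectedComponentIn_eq hw]
    exact mem_connectedComponentIn hzX
  rw [hopen.frontier_eq] at hz
  exact hz.2 this

/-- Otherwise extend the logarithm to `G` on the whole plane by Tietze. Then `(z - b) * exp (G z)`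
on the component and `z - a` off it agree on the frontier, so they form a zero-free continuous
function equal to `z - a` on a large circle. -/
theorem mem_connectedComponentIn_of_hasContinuousLogOn_of_isBounded {X : Set ℂ} (hX : IsClosed X)
    {a b : ℂ} (ha : a ∉ X) (hb : b ∉ X) (hlog : HasContinuousLogOn (fun z => (z - a) / (z - b)) X)
    (hbdd : Bornology.IsBounded (connectedComponentIn Xᶜ a)) :
    b ∈ connectedComponentIn Xᶜ a := by
  classical
  by_contra hbU
  set U := connectedComponentIn Xᶜ a
  obtain ⟨g, hg, hg'⟩ := hlog
  obtain ⟨G, hG⟩ := ContinuousMap.exists_restrict_eq hX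
    (⟨X.domRestrict g, continuousOn_iff_continuous_domRestrict.1 hg⟩ : C(X, ℂ))
  have hG' : ∀ z ∈ X, G z = g z := fun z hz => congrArg (fun f : C(X, ℂ) => f ⟨z, hz⟩) hG
  have haU : a ∈ U := mem_connectedComponentIn ha
  obtain ⟨r, hr⟩ := hbdd.subset_ball a
  have hr0 : 0 < r := by simpa using hr haU
  obtain ⟨z, hz, hne⟩ := exists_ne_sub_of_continuous
    (φ := fun z => if z ∈ U then (z - b) * Complex.exp (G z) else z - a)
    (by
      refine Continuous.if (fun z hz => ?_) (by fun_prop) (by fun_prop)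
      have hzX : z ∈ X := frontier_connectedComponentIn_compl_subset hX a hz
      rw [hG' z hzX, hg' z hzX, mul_div_cancel₀]
      exact sub_ne_zero.2 fun h => hb (h ▸ hzX))
    (by
      intro z
      split_ifs with hz
      · exact mul_ne_zero (sub_ne_zero.2 fun h => hbU (h ▸ hz)) (Complex.exp_ne_zero _)
      · exact sub_ne_zero.2 fun h => hz (h ▸ haU)) a hr0
  refine hne (if_neg fun hzU => ?_)
  have := hr hzU
  rw [mem_ball, dist_eq_norm, hz] at this
  exact this.false

theorem isPreconnected_norm_gt {R : ℝ} (hR : 0 < R) : IsPreconnected {z : ℂ | R < ‖z‖} := by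
  have : {z : ℂ | R < ‖z‖} = Complex.exp '' {w | Real.log R < w.re} := by
    ext z
    constructor
    · intro hz
      have hz' : R < ‖z‖ := hz
      refine ⟨Complex.log z, ?_, Complex.exp_log (norm_pos_iff.1 (hR.trans hz'))⟩
      simpa [Complex.log_re] using Real.log_lt_log hR hz'
    · rintro ⟨w, hw, rfl⟩
      simpa [Complex.norm_exp] using (Real.log_lt_iff_lt_exp hR).1 hw
  rw [this]
  exact (convex_halfSpace_re_gt _).isPreconnected.image _ Complex.continuous_exp.continuousOn

/-- Components meeting the connected exterior of a large disc coincide. If one of the two misses it,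
that component is bounded, with the logarithm negated when it is that of `b`. -/
theorem mem_connectedComponentIn_of_hasContinuousLogOn {X : Set ℂ} (hX : IsCompact X)
    {a b : ℂ} (ha : a ∉ X) (hb : b ∉ X)
    (hlog : HasContinuousLogOn (fun z => (z - a) / (z - b)) X) :
    b ∈ connectedComponentIn Xᶜ a := by
  obtain ⟨R, hR0, hR⟩ := hX.isBounded.subset_closedBall_lt 0 0
  set W := {z : ℂ | R < ‖z‖}
  have hWX : W ⊆ Xᶜ := fun z hz hzX => by
    have := hR hzX
    rw [mem_closedBall, dist_zero_right] at this
    exact (lt_of_lt_of_le hz this).false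
  have hWc : IsPreconnected W := isPreconnected_norm_gt hR0
  have bdd : ∀ c, Disjoint W (connectedComponentIn Xᶜ c) →
      Bornology.IsBounded (connectedComponentIn Xᶜ c) := fun c hc =>
    isBounded_closedBall (x := (0 : ℂ)) (r := R) |>.subset fun z hz => by
      rw [mem_closedBall, dist_zero_right]
      by_contra! h
      exact disjoint_left.1 hc h hz
  by_cases hWa : Disjoint W (connectedComponentIn Xᶜ a)
  · exact mem_connectedComponentIn_of_hasContinuousLogOn_of_isBounded hX.isClosed ha hb hlog
      (bdd a hWa)
  by_cases hWb : Disjoint W (connectedComponentIn Xᶜ b)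
  · obtain ⟨g, hg, hg'⟩ := hlog
    have := mem_connectedComponentIn_of_hasContinuousLogOn_of_isBounded hX.isClosed hb ha
      ⟨fun z => -g z, hg.neg, fun z hz => by rw [Complex.exp_neg, hg' z hz, inv_div]⟩ (bdd b hWb)
    rw [← connectedComponentIn_eq this]
    exact mem_connectedComponentIn hb
  obtain ⟨x, hxW, hxa⟩ := not_disjoint_iff.1 hWa
  obtain ⟨y, hyW, hyb⟩ := not_disjoint_iff.1 hWb
  rw [connectedComponentIn_eq hxa]
  have := hWc.subset_connectedComponentIn hxW hWX hyW
  rw [connectedComponentIn_eq this, ← connectedComponentIn_eq hyb]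
  exact mem_connectedComponentIn hb

/-- **Janiszewski's theorem**: if two compact sets in the plane have connected intersection and
neither of them separates `a` from `b`, then their union does not separate `a` from `b`. -/
theorem mem_connectedComponentIn_compl_union {A B : Set ℂ} (hA : IsCompact A) (hB : IsCompact B)
    (hAB : IsConnected (A ∩ B)) {a b : ℂ} (hab : JoinedIn Aᶜ a b) (hab' : JoinedIn Bᶜ a b) :
    b ∈ connectedComponentIn (A ∪ B)ᶜ a := by
  have log : ∀ {K : Set ℂ}, IsCompact K → JoinedIn Kᶜ a b →
      HasContinuousLogOn (fun z => (z - a) / (z - b)) K := by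
    intro K hK h
    refine hasContinuousLogOn_div_of_isPreconnected hK.isClosed
      (isPreconnected_connectedComponentIn (x := a)) (connectedComponentIn_subset _ _)
      (mem_connectedComponentIn h.source_mem) ?_
    have hrange := isPreconnected_range h.somePath.continuous
    exact hrange.subset_connectedComponentIn ⟨0, by simp⟩
      (range_subset_iff.2 h.somePath_mem) ⟨1, by simp⟩
  refine mem_connectedComponentIn_of_hasContinuousLogOn (hA.union hB) ?_ ?_
    ((log hA hab).union hA.isClosed hB.isClosed hAB (log hB hab'))
  · exact fun h => h.elim hab.source_mem hab'.source_mem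
  · exact fun h => h.elim hab.target_mem hab'.target_mem

/-- Suppose that the compact sets `X` and `σ` meet in at most two points, both in the closure of a
connected set `O`. If `a` can be joined to `b` by paths avoiding `O` and these points, one avoiding
`X` and one avoiding `σ`, then `X ∪ σ` does not separate `a` from `b`. -/
theorem mem_connectedComponentIn_compl_of_joinedIn {X σ O : Set ℂ} {a b u v : ℂ}
    (hX : IsCompact X) (hσ : IsCompact σ) (hXσ : X ∩ σ ⊆ {u, v}) (hO : IsPreconnected O)
    (hu : u ∈ closure O) (hv : v ∈ closure O) (hδ : JoinedIn (X ∪ (O ∪ {u, v}))ᶜ a b)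
    (hγ : JoinedIn (σ ∪ (O ∪ {u, v}))ᶜ a b) : b ∈ connectedComponentIn (X ∪ σ)ᶜ a := by
  set δ := hδ.somePath
  set γ := hγ.somePath
  have hK : IsOpen (range δ ∪ range γ)ᶜ :=
    ((isCompact_range δ.continuous).union (isCompact_range γ.continuous)).isClosed.isOpen_compl
  have hOuv : IsPreconnected (O ∪ {u, v}) := hO.subset_closure subset_union_left
    (union_subset subset_closure (insert_subset hu (singleton_subset_iff.2 hv)))
  have hsub : O ∪ {u, v} ⊆ (range δ ∪ range γ)ᶜ := by
    rintro z hz (⟨t, rfl⟩ | ⟨t, rfl⟩)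
    · exact hδ.somePath_mem t (Or.inr hz)
    · exact hγ.somePath_mem t (Or.inr hz)
  have hu' : u ∈ O ∪ {u, v} := by simp
  have hv' : v ∈ O ∪ {u, v} := by simp
  have hpath : IsPathConnected (connectedComponentIn (range δ ∪ range γ)ᶜ u) :=
    hK.connectedComponentIn.isConnected_iff_isPathConnected.1
      (isConnected_connectedComponentIn_iff.2 (hsub hu'))
  -- The connected set `O ∪ {u, v}` avoids both paths, so `u` and `v` are joined by a path `β`
  -- avoiding them too. Adding `β` to `X` and to `σ` makes the intersection exactly `β`, as
  -- Janiszewski's theorem requires.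
  have huv : JoinedIn (range δ ∪ range γ)ᶜ u v :=
    (hpath.joinedIn u (mem_connectedComponentIn (hsub hu')) v
      (hOuv.subset_connectedComponentIn hu' hsub hv')).mono (connectedComponentIn_subset _ _)
  set β := huv.somePath
  have hβ : ∀ t, β t ∈ (range δ ∪ range γ)ᶜ := huv.somePath_mem
  have hinter : (X ∪ range β) ∩ (σ ∪ range β) = range β := by
    rw [← inter_union_distrib_right]
    refine union_eq_right.2 (hXσ.trans ?_)
    exact insert_subset ⟨0, by simp⟩ (singleton_subset_iff.2 ⟨1, by simp⟩)
  have hcpt := isCompact_range β.continuous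
  have := mem_connectedComponentIn_compl_union (hX.union hcpt) (hσ.union hcpt)
    (by rw [hinter]; exact isConnected_range β.continuous) (a := a) (b := b)
    ⟨δ, fun t => by
      rintro (h | ⟨t', h⟩)
      · exact hδ.somePath_mem t (Or.inl h)
      · exact hβ t' (Or.inl (h ▸ mem_range_self t))⟩
    ⟨γ, fun t => by
      rintro (h | ⟨t', h⟩)
      · exact hγ.somePath_mem t (Or.inl h)
      · exact hβ t' (Or.inr (h ▸ mem_range_self t))⟩
  refine connectedComponentIn_mono a (compl_subset_compl.2 ?_) this
  exact union_subset_union subset_union_left subset_union_left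

/-! ### Faces of a plane map and the forest they form -/

namespace PlaneMap

variable {V E : Type*} {G : PlaneMap V E} {F F' O : Set ℂ} {e : E} {s t : unitInterval}

theorem arc_range_subset_support (G : PlaneMap V E) (e : E) : range (G.arc e) ⊆ G.support :=
  fun _ hz => Or.inr (mem_iUnion.2 ⟨e, hz⟩)

theorem arc_mem_range_pos_or_mem_Ioo (G : PlaneMap V E) (e : E) (r : unitInterval) :
    G.arc e r ∈ range G.pos ∨ r ∈ Ioo (0 : unitInterval) 1 := by
  rcases eq_or_lt_of_le (unitInterval.nonneg' (t := r)) with rfl | h0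
  · exact Or.inl ⟨_, (G.arc e).source.symm⟩
  rcases eq_or_lt_of_le (unitInterval.le_one' (t := r)) with rfl | h1
  · exact Or.inl ⟨_, (G.arc e).target.symm⟩
  · exact Or.inr ⟨h0, h1⟩

theorem Ioo_subset_Ioo_zero_one (s t : unitInterval) : Ioo s t ⊆ Ioo 0 1 :=
  Ioo_subset_Ioo unitInterval.nonneg' unitInterval.le_one'

theorem isPathConnected_Ioo_unitInterval (hst : s < t) : IsPathConnected (Ioo s t) := by
  have : Ioo s t = projIcc (0 : ℝ) 1 zero_le_one '' Ioo (s : ℝ) t := by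
    apply Subset.antisymm
    · exact fun r hr => ⟨r, hr, projIcc_val _ r⟩
    · rintro _ ⟨r, hr, rfl⟩
      rw [projIcc_of_mem zero_le_one ⟨s.2.1.trans hr.1.le, hr.2.le.trans t.2.2⟩]
      exact hr
  rw [this]
  exact ((convex_Ioo (s : ℝ) t).isPathConnected (nonempty_Ioo.2 hst)).image continuous_projIcc

theorem arc_notMem_image_Ioo {r : unitInterval} (hr : r ∉ Ioo s t) :
    G.arc e r ∉ G.arc e '' Ioo s t := by
  rintro ⟨q, hq, heq⟩
  have hq' := Ioo_subset_Ioo_zero_one s t hq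
  rcases G.arc_mem_range_pos_or_mem_Ioo e r with ⟨v, hv⟩ | h
  · exact G.arc_ne_pos e q hq' v (heq.trans hv.symm)
  · exact hr (G.arc_injOn e hq' h heq ▸ hq)

theorem arc_notMem_image_Ioo_of_ne {f : E} (hf : f ≠ e) (r : unitInterval) :
    G.arc f r ∉ G.arc e '' Ioo s t := by
  rintro ⟨q, hq, heq⟩
  have hq' := Ioo_subset_Ioo_zero_one s t hq
  rcases G.arc_mem_range_pos_or_mem_Ioo f r with ⟨v, hv⟩ | h
  · exact G.arc_ne_pos e q hq' v (heq.trans hv.symm)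
  · exact disjoint_left.1 (G.arc_disjoint f e hf) ⟨r, h, rfl⟩ ⟨q, hq', heq⟩

theorem isCompact_support_diff [Finite V] [Finite E] (G : PlaneMap V E) (e : E)
    (s t : unitInterval) : IsCompact (G.support \ G.arc e '' Ioo s t) := by
  have : G.support \ G.arc e '' Ioo s t = (range G.pos ∪ ⋃ f : {f // f ≠ e}, range (G.arc f)) ∪
      (G.arc e '' Iic s ∪ G.arc e '' Ici t) := by
    apply Subset.antisymm
    · rintro z ⟨hz | hz, hz'⟩
      · exact Or.inl (Or.inl hz)
      · obtain ⟨f, r, rfl⟩ := mem_iUnion.1 hz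
        by_cases hf : f = e
        · subst hf
          have : r ∉ Ioo s t := fun h => hz' ⟨r, h, rfl⟩
          rcases le_or_gt r s with h | h
          · exact Or.inr (Or.inl ⟨r, h, rfl⟩)
          · exact Or.inr (Or.inr ⟨r, not_lt.1 fun h' => this ⟨h, h'⟩, rfl⟩)
        · exact Or.inl (Or.inr (mem_iUnion.2 ⟨⟨f, hf⟩, r, rfl⟩))
    · rintro z ((⟨v, rfl⟩ | hz) | (⟨r, hr, rfl⟩ | ⟨r, hr, rfl⟩))
      · exact ⟨Or.inl ⟨v, rfl⟩, fun ⟨q, hq, h⟩ =>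
          G.arc_ne_pos e q (Ioo_subset_Ioo_zero_one s t hq) v h⟩
      · obtain ⟨f, r, rfl⟩ := mem_iUnion.1 hz
        exact ⟨G.arc_range_subset_support f ⟨r, rfl⟩, arc_notMem_image_Ioo_of_ne f.2 r⟩
      · exact ⟨G.arc_range_subset_support e ⟨r, rfl⟩,
          arc_notMem_image_Ioo fun h => (not_lt.2 hr) h.1⟩
      · exact ⟨G.arc_range_subset_support e ⟨r, rfl⟩,
          arc_notMem_image_Ioo fun h => (not_lt.2 hr) h.2⟩
  rw [this]
  exact ((finite_range G.pos).isCompact.union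
    (isCompact_iUnion fun f : {f // f ≠ e} => isCompact_range (G.arc f).continuous)).union
    ((isClosed_Iic.isCompact.image (G.arc e).continuous).union
      (isClosed_Ici.isCompact.image (G.arc e).continuous))

theorem isCompact_support [Finite V] [Finite E] (G : PlaneMap V E) : IsCompact G.support :=
  (finite_range _).isCompact.union (isCompact_iUnion fun f => isCompact_range (G.arc f).continuous)

theorem IsFace.subset_compl (hF : G.IsFace F) : F ⊆ G.supportᶜ := by
  obtain ⟨z, -, rfl⟩ := hF
  exact connectedComponentIn_subset _ _

theorem IsFace.isPreconnected (hF : G.IsFace F) : IsPreconnected F := by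
  obtain ⟨z, -, rfl⟩ := hF
  exact isPreconnected_connectedComponentIn

theorem IsFace.nonempty (hF : G.IsFace F) : F.Nonempty := by
  obtain ⟨z, hz, rfl⟩ := hF
  exact ⟨z, mem_connectedComponentIn hz⟩

theorem IsFace.eq_connectedComponentIn (hF : G.IsFace F) {a : ℂ} (ha : a ∈ F) :
    F = connectedComponentIn G.supportᶜ a := by
  obtain ⟨z, -, rfl⟩ := hF
  exact connectedComponentIn_eq ha

theorem IsFace.disjoint (hF : G.IsFace F) (hF' : G.IsFace F') (hne : F ≠ F') : Disjoint F F' :=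
  disjoint_left.2 fun _ ha ha' =>
    hne ((hF.eq_connectedComponentIn ha).trans (hF'.eq_connectedComponentIn ha').symm)

theorem IsFace.isOpen [Finite V] [Finite E] (hF : G.IsFace F) : IsOpen F := by
  obtain ⟨z, -, rfl⟩ := hF
  exact G.isCompact_support.isClosed.isOpen_compl.connectedComponentIn

theorem IsFace.joinedIn [Finite V] [Finite E] (hF : G.IsFace F) {a b : ℂ} (ha : a ∈ F)
    (hb : b ∈ F) : JoinedIn F a b :=
  (hF.isOpen.isConnected_iff_isPathConnected.1 ⟨hF.nonempty, hF.isPreconnected⟩).joinedIn a ha b hb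

/-- Every open subarc of an edge on the boundary of a face contains a point accessible from
that face. -/
theorem IsFace.exists_joinedIn_arc [Finite V] [Finite E] (hF : G.IsFace F)
    (he : range (G.arc e) ⊆ frontier F) (hst : s < t) {a : ℂ} (ha : a ∈ F) :
    ∃ p ∈ G.arc e '' Ioo s t, JoinedIn (F ∪ G.arc e '' Ioo s t) a p := by
  obtain ⟨r, hr⟩ := exists_between hst
  have hq : G.arc e r ∈ (G.support \ G.arc e '' Ioo s t)ᶜ := fun h => h.2 ⟨r, hr, rfl⟩
  obtain ⟨ε, hε, hball⟩ := Metric.isOpen_iff.1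
    (G.isCompact_support_diff e s t).isClosed.isOpen_compl _ hq
  obtain ⟨z, hz, hzF⟩ := mem_closure_iff.1 (he ⟨r, rfl⟩).1 _ isOpen_ball
    (mem_ball_self (x := G.arc e r) (half_pos hε))
  have hrX : G.arc e r ∈ G.support := G.arc_range_subset_support e ⟨r, rfl⟩
  -- A point of the drawing nearest to `z` is within `ε` of `G.arc e r`, hence on the subarc, and
  -- the segment from `z` to it stays in the face until its end.
  obtain ⟨p, hpX, hp⟩ := G.isCompact_support.exists_infDist_eq_dist ⟨_, hrX⟩ z
  have hzp : dist z p < ε / 2 := (hp ▸ infDist_le_dist_of_mem hrX).trans_lt (mem_ball.1 hz)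
  have hpe : p ∈ G.arc e '' Ioo s t := by
    by_contra h
    refine hball ?_ ⟨hpX, h⟩
    have := dist_triangle_left p (G.arc e r) z
    rw [mem_ball] at hz ⊢
    linarith
  have hballF : ball z (dist z p) ⊆ F := by
    rw [hF.eq_connectedComponentIn hzF]
    have hpos : 0 < dist z p := dist_pos.2 fun h => hF.subset_compl hzF (h ▸ hpX)
    refine (convex_ball z _).isPreconnected.subset_connectedComponentIn (mem_ball_self hpos) ?_
    intro w hw hwX
    have := infDist_le_dist_of_mem (x := z) hwX
    rw [mem_ball, dist_comm] at hw
    linarith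
  refine ⟨p, hpe, ((hF.joinedIn ha hzF).mono subset_union_left).trans ?_⟩
  refine JoinedIn.of_segment_subset fun w hw => ?_
  rcases eq_or_ne w p with rfl | hwp
  · exact Or.inr hpe
  · refine Or.inl (hballF ?_)
    have h := dist_add_dist_of_mem_segment hw
    have := dist_pos.2 hwp
    rw [mem_ball, dist_comm]
    linarith

/-- Two faces sharing an edge can be joined across any open subarc of that edge. -/
theorem IsFace.joinedIn_across [Finite V] [Finite E] (hF : G.IsFace F) (hF' : G.IsFace F')
    (he : range (G.arc e) ⊆ frontier F) (he' : range (G.arc e) ⊆ frontier F') (hst : s < t)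
    {a b : ℂ} (ha : a ∈ F) (hb : b ∈ F') : JoinedIn (F ∪ F' ∪ G.arc e '' Ioo s t) a b := by
  obtain ⟨p, hp, hap⟩ := hF.exists_joinedIn_arc he hst ha
  obtain ⟨q, hq, hbq⟩ := hF'.exists_joinedIn_arc he' hst hb
  have hpc : IsPathConnected (G.arc e '' Ioo s t) := by
    refine IsPathConnected.image ?_ (G.arc e).continuous
    exact isPathConnected_Ioo_unitInterval hst
  refine (hap.mono ?_).trans (((hpc.joinedIn p hp q hq).mono subset_union_right).trans
    (hbq.symm.mono ?_))
  · exact union_subset_union_left _ subset_union_left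
  · exact union_subset_union_left _ subset_union_right

/-- Let `e` be an edge on the boundaries of the distinct faces `F` and `F'`, and let `O` be a third
face whose closure contains the ends of a closed subarc of `e`. Then this subarc and `O` together
separate `F` from `F'`. -/
theorem IsFace.not_joinedIn_compl [Finite V] [Finite E] (hF : G.IsFace F) (hF' : G.IsFace F')
    (hO : G.IsFace O) (hne : F ≠ F') (hFO : F ≠ O) (hFO' : F' ≠ O)
    (he : range (G.arc e) ⊆ frontier F) (he' : range (G.arc e) ⊆ frontier F') (hst : s < t)
    (hs : G.arc e s ∈ closure O) (ht : G.arc e t ∈ closure O) {a b : ℂ} (ha : a ∈ F)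
    (hb : b ∈ F') : ¬ JoinedIn (G.arc e '' Icc s t ∪ O)ᶜ a b := by
  intro hγ
  have hends : {G.arc e s, G.arc e t} ⊆ G.arc e '' Icc s t :=
    insert_subset ⟨s, left_mem_Icc.2 hst.le, rfl⟩
      (singleton_subset_iff.2 ⟨t, right_mem_Icc.2 hst.le, rfl⟩)
  have hendsX : {G.arc e s, G.arc e t} ⊆ G.support :=
    hends.trans ((image_subset_range _ _).trans (G.arc_range_subset_support e))
  have hends' : ∀ z ∈ ({G.arc e s, G.arc e t} : Set ℂ), z ∉ G.arc e '' Ioo s t := by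
    rintro z (rfl | rfl)
    · exact arc_notMem_image_Ioo fun h => lt_irrefl _ h.1
    · exact arc_notMem_image_Ioo fun h => lt_irrefl _ h.2
  have hOX := hO.subset_compl
  -- The drawing splits into the closed subarc and the rest, meeting only at the ends of the subarc.
  -- Crossing the open subarc avoids the rest, and the supposed path avoids the subarc; together
  -- they would make `F` and `F'` one face.
  have key := mem_connectedComponentIn_compl_of_joinedIn (G.isCompact_support_diff e s t)
    (isCompact_Icc.image (G.arc e).continuous) (σ := G.arc e '' Icc s t) (u := G.arc e s)
    (v := G.arc e t) (O := O) (a := a) (b := b) ?_ hO.isPreconnected hs ht ?_ ?_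
  · have hunion : G.support \ G.arc e '' Ioo s t ∪ G.arc e '' Icc s t = G.support := by
      apply Subset.antisymm
      · exact union_subset sdiff_subset
          ((image_subset_range _ _).trans (G.arc_range_subset_support e))
      · intro z hz
        by_cases h : z ∈ G.arc e '' Ioo s t
        · exact Or.inr (image_mono Ioo_subset_Icc_self h)
        · exact Or.inl ⟨hz, h⟩
    rw [hunion, ← hF.eq_connectedComponentIn ha] at key
    exact disjoint_left.1 (hF.disjoint hF' hne) key hb
  · rintro z ⟨⟨-, hz⟩, ⟨r, hr, rfl⟩⟩
    rcases eq_or_lt_of_le hr.1 with rfl | h1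
    · exact Or.inl rfl
    rcases eq_or_lt_of_le hr.2 with rfl | h2
    · exact Or.inr rfl
    · exact absurd ⟨r, ⟨h1, h2⟩, rfl⟩ hz
  · refine (hF.joinedIn_across hF' he he' hst ha hb).mono ?_
    rintro z ((hz | hz) | hz) (h | h | h)
    · exact hF.subset_compl hz h.1
    · exact disjoint_left.1 (hF.disjoint hO hFO) hz h
    · exact hF.subset_compl hz (hendsX h)
    · exact hF'.subset_compl hz h.1
    · exact disjoint_left.1 (hF'.disjoint hO hFO') hz h
    · exact hF'.subset_compl hz (hendsX h)
    · exact h.2 hz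
    · exact hOX h (G.arc_range_subset_support e (image_subset_range _ _ hz))
    · exact hends' z h hz
  · refine hγ.mono (compl_subset_compl.2 ?_)
    exact union_subset subset_union_left (union_subset subset_union_right
      (hends.trans subset_union_left))

/-- An edge lies on the boundary of at most two faces. -/
theorem IsFace.eq_or_eq_of_arc_subset_frontier [Finite V] [Finite E] (hF : G.IsFace F)
    (hF' : G.IsFace F') (hO : G.IsFace O) (hne : F ≠ F') (he : range (G.arc e) ⊆ frontier F)
    (he' : range (G.arc e) ⊆ frontier F') (heO : range (G.arc e) ⊆ frontier O) :
    O = F ∨ O = F' := by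
  by_contra! H
  obtain ⟨a, ha⟩ := hF.nonempty
  obtain ⟨b, hb⟩ := hF'.nonempty
  -- Cut `e` at `t`: the first piece and `O` would separate `F` from `F'`, which are nevertheless
  -- joined across the second piece.
  obtain ⟨t, h0t, ht1⟩ := exists_between (zero_lt_one (α := unitInterval))
  refine hF.not_joinedIn_compl hF' hO hne H.1.symm H.2.symm he he' h0t
    (frontier_subset_closure (heO ⟨0, rfl⟩)) (frontier_subset_closure (heO ⟨t, rfl⟩)) ha hb ?_
  refine (hF.joinedIn_across hF' he he' ht1 ha hb).mono ?_
  rintro z ((hz | hz) | hz) (h | h)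
  · exact hF.subset_compl hz (G.arc_range_subset_support e (image_subset_range _ _ h))
  · exact disjoint_left.1 (hF.disjoint hO H.1.symm) hz h
  · exact hF'.subset_compl hz (G.arc_range_subset_support e (image_subset_range _ _ h))
  · exact disjoint_left.1 (hF'.disjoint hO H.2.symm) hz h
  · obtain ⟨r, hr, rfl⟩ := h
    exact arc_notMem_image_Ioo (fun h => not_lt.2 hr.2 h.1) hz
  · exact hO.subset_compl h (G.arc_range_subset_support e (image_subset_range _ _ hz))

/-- The adjacency graph of the faces other than `O`. -/
def faceGraph (G : PlaneMap V E) (O : G.Face) : SimpleGraph {F : G.Face // F ≠ O} where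
  Adj F F' := F ≠ F' ∧ G.ShareEdge F.1 F'.1
  symm := ⟨fun _ _ h => ⟨h.1.symm, h.2.imp fun _ he => he.trans (inter_comm _ _).subset⟩⟩
  loopless := ⟨fun _ h => h.1 rfl⟩

/-- If every vertex lies on the boundary of `O`, then the other faces form a forest. -/
theorem isAcyclic_faceGraph [Finite V] [Finite E] (G : PlaneMap V E) (O : G.Face)
    (hO : ∀ v, G.pos v ∈ frontier O.1) : (G.faceGraph O).IsAcyclic := by
  rw [SimpleGraph.isAcyclic_iff_forall_adj_isBridge]
  rintro F F' ⟨hne, e, he⟩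
  rw [SimpleGraph.isBridge_iff]
  rintro ⟨p⟩
  have heF := he.trans inter_subset_left
  have heF' := he.trans inter_subset_right
  have hval : ∀ {A B : {F : G.Face // F ≠ O}}, A ≠ B → A.1.1 ≠ B.1.1 := fun h h' =>
    h (Subtype.ext (Subtype.ext h'))
  have hvalO : ∀ A : {F : G.Face // F ≠ O}, A.1.1 ≠ O.1 := fun A h => A.2 (Subtype.ext h)
  have face_sub : ∀ A : {F : G.Face // F ≠ O}, A.1.1 ⊆ (range (G.arc e) ∪ O.1)ᶜ := by
    rintro A z hz (h | h)
    · exact A.1.2.subset_compl hz (G.arc_range_subset_support e h)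
    · exact disjoint_left.1 (A.1.2.disjoint O.2 (hvalO A)) hz h
  have key : ∀ {A B} (_ : ((G.faceGraph O).deleteEdges {s(F, F')}).Walk A B) (a b : ℂ),
      a ∈ A.1.1 → b ∈ B.1.1 → JoinedIn (range (G.arc e) ∪ O.1)ᶜ a b := by
    intro A B q
    induction q with
    | nil => exact fun a b ha hb => (IsFace.joinedIn (Subtype.property _) ha hb).mono (face_sub _)
    | @cons A B C hAB q ih =>
      intro a b ha hb
      obtain ⟨⟨hneAB, f, hf⟩, hdel⟩ := SimpleGraph.deleteEdges_adj.1 hAB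
      obtain ⟨c, hc⟩ := B.1.2.nonempty
      -- Only `F` and `F'` have `e` on their boundary, so crossing `e` would use the deleted
      -- adjacency.
      have hfe : f ≠ e := by
        rintro rfl
        have two : ∀ K : {F : G.Face // F ≠ O}, range (G.arc f) ⊆ frontier K.1.1 →
            K = F ∨ K = F' := fun K hK =>
          (F.1.2.eq_or_eq_of_arc_subset_frontier F'.1.2 K.1.2 (hval hne) heF heF' hK).imp
            (fun h => Subtype.ext (Subtype.ext h)) (fun h => Subtype.ext (Subtype.ext h))
        have hA := two A (hf.trans inter_subset_left)
        have hB := two B (hf.trans inter_subset_right)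
        apply hdel
        rcases hA with rfl | rfl <;> rcases hB with rfl | rfl
        · exact absurd rfl hneAB
        · exact rfl
        · exact Sym2.eq_swap
        · exact absurd rfl hneAB
      refine JoinedIn.trans ?_ (ih c b hc hb)
      refine (A.1.2.joinedIn_across B.1.2 (hf.trans inter_subset_left)
        (hf.trans inter_subset_right) zero_lt_one ha hc).mono ?_
      refine union_subset (union_subset (face_sub A) (face_sub B)) ?_
      rintro z hz (⟨r, rfl⟩ | h)
      · exact arc_notMem_image_Ioo_of_ne hfe.symm r hz
      · exact O.2.subset_compl h (G.arc_range_subset_support f (image_subset_range _ _ hz))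
  obtain ⟨a, ha⟩ := F.1.2.nonempty
  obtain ⟨b, hb⟩ := F'.1.2.nonempty
  refine F.1.2.not_joinedIn_compl F'.1.2 O.2 (hval hne) (hvalO F) (hvalO F') heF heF'
    zero_lt_one ?_ ?_ ha hb ((key p a b ha hb).mono (compl_subset_compl.2
      (union_subset_union_left _ (image_subset_range _ _))))
  · rw [(G.arc e).source]
    exact frontier_subset_closure (hO _)
  · rw [(G.arc e).target]
    exact frontier_subset_closure (hO _)

end PlaneMap

end PlaneTopology

/-! ### The fifth colour -/

theorem theorem1 {V E : Type*} [Finite V] [Finite E] (G : PlaneMap V E)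
    (hG : G.IsOuterplanar) :
    ∃ c : G.Face → Fin 5, G.IsNonrepetitive c := by
  classical
  obtain ⟨O, hO, -, hOv⟩ := hG
  let O' : G.Face := ⟨O, hO⟩
  obtain ⟨c, hc⟩ := (G.isAcyclic_faceGraph O' hOv).exists_nonrepetitive_coloring
  let col : G.Face → Fin 5 := fun F => if h : F = O' then Fin.last 4 else (c ⟨F, h⟩).castSucc
  have hlast : ∀ F, col F = Fin.last 4 → F = O' := by
    intro F hF
    by_contra h
    simp only [col, dif_neg h] at hF
    exact Fin.castSucc_ne_last _ hF
  refine ⟨col, fun l hnd hch u hu hsq => ?_⟩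
  obtain ⟨pre, post, h⟩ := hsq
  obtain ⟨l₁, l₂, rfl, h, -⟩ := List.map_eq_append_iff.1 h.symm
  obtain ⟨l₀, l₁, rfl, -, h⟩ := List.map_eq_append_iff.1 h
  obtain ⟨x, y, rfl, hx, hy⟩ := List.map_eq_append_iff.1 h
  have hnd' : (x ++ y).Nodup := ((List.nodup_append.1 (List.nodup_append.1 hnd).1).2).1
  have hch' : (x ++ y).IsChain G.ShareEdge := hch.left_of_append.right_of_append
  -- The colour of `O'` would occur in both halves of the square, and it belongs to `O'` alone, so
  -- `O'` would be visited twice.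
  have hOxy : ∀ F ∈ x ++ y, F ≠ O' := by
    rintro F hF rfl
    have hmem : col O' ∈ u := by
      rcases List.mem_append.1 hF with h | h
      · exact hx ▸ List.mem_map_of_mem h
      · exact hy ▸ List.mem_map_of_mem h
    have hcol : col O' = Fin.last 4 := dif_pos rfl
    obtain ⟨A, hA, hA'⟩ := List.mem_map.1 (hx ▸ hmem)
    obtain ⟨B, hB, hB'⟩ := List.mem_map.1 (hy ▸ hmem)
    exact (List.nodup_append.1 hnd').2.2 A hA B hB
      ((hlast A (hA'.trans hcol)).trans (hlast B (hB'.trans hcol)).symm)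
  lift x to List {F : G.Face // F ≠ O'} using fun F hF => hOxy F (List.mem_append_left _ hF)
  lift y to List {F : G.Face // F ≠ O'} using fun F hF => hOxy F (List.mem_append_right _ hF)
  rw [← List.map_append] at hnd' hch'
  have hxy : x.map c = y.map c := by
    have hcol : col ∘ Subtype.val = Fin.castSucc ∘ c := funext fun F => dif_neg F.2
    have := hx.trans hy.symm
    rw [List.map_map, List.map_map, hcol, ← List.map_map, ← List.map_map] at this
    exact List.map_injective_iff.2 (Fin.castSucc_injective 4) this
  have hnd'' : (x ++ y).Nodup := hnd'.of_map _
  refine hc (x ++ y) hnd'' ?_ (x.map c) ?_ ⟨[], [], by simp [← hxy]⟩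
  · rw [List.isChain_iff_getElem]
    intro i hi
    -- Adjacency in the forest also demands distinct faces, which comes from the absence of
    -- repetitions.
    refine ⟨fun h => ?_, ?_⟩
    · have := hnd''.getElem_inj_iff.1 h
      omega
    · have := List.isChain_iff_getElem.1 hch' i (by simpa using hi)
      simpa only [List.getElem_map] using this
  · rintro h
    rw [List.map_eq_nil_iff] at h
    subst h
    exact hu (by simpa using hx.symm)
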